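/- Throughout, $K$ is a field, and for an integer matrix $A$ with $n$ columns and $\mathrm{Ker}_{\mathbb Z}(A)\cap\mathbb N^n=\{0\}$, $I_A\subset K[x_1,\dots,x_n]$ is the toric ideal generated by the binomials $x^{u^+}-x^{u^-}$, $u\in \mathrm{Ker}_{\mathbb Z}(A)$. The set $\mathrm{Gr}(A)$ consists of the nonzero $u\in\mathrm{Ker}_{\mathbb Z}(A)$ that are not of the form $u=v+w$ with $v,w\in\mathrm{Ker}_{\mathbb Z}(A)\setminus\{0\}$, $u^+=v^++w^+$ and $u^-=v^-+w^-$; the set $S(A)$ consists of the nonzero $u\in\mathrm{Ker}_{\mathbb Z}(A)$ that are not of the form $u=v+w$ with $v,w\in\mathrm{Ker}_{\mathbb Z}(A)\setminus\{0\}$ such that no coordinate $x$ has $v_x>0$ and $w_x<0$. The ideal $I_A$ is strongly robust if its Graver basis $\{x^{u^+}-x^{u^-}: u\in \mathrm{Gr}(A)\}$ (opposite binomials being identified) is a minimal system of generators of $I_A$. Bouquets. Let $G(a_x)$ be the rows of a matrix whose columns form a basis of $\mathrm{Ker}_{\mathbb Z}(A)$. The bouquets of $A$ are the connected components of the graph on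 the columns $a_x$ of $A$ in which $a_x,a_y$ are joined if $G(a_x)$ and $G(a_y)$ are rational multiples of each other. The bouquet of columns with $G(a_x)=0$, if there are any, is called free; any other bouquet is non-mixed if along all its edges $G(a_x)=\lambda G(a_y)$ with $\lambda>0$ (an isolated vertex is non-mixed), and mixed otherwise. Let $B_1,\dots,B_s$ be the bouquets, the columns being listed as $a_{j1},\dots,a_{jk_j}$ in $B_j$. If $B_j$ is not free, put $c_{jt}=\varepsilon\, G(a_{jt})_l/g$, where $l$ is a coordinate in which all $G(a_{jt})$ are nonzero, $g$ is the greatest common divisor of the $G(a_{jt})_l$, and $\varepsilon=\pm1$ is such that $c_{j1}>0$; if $B_j$ is free, $(c_{jt})_t$ is any integer vector of full support with $c_{j1}>0$. Put $D(u)=(c_{11}u_1,\dots,c_{1k_1}u_1,\dots,c_{s1}u_s,\dots,c_{sk_s}u_s)$. The bouquet ideal of $I_A$ is the toric ideal in $K[x_1,\dots,x_s]$ of the matrix with columns $\sum_t c_{jt}a_{jt}$, $1\le j\le s$. The strongly robust complex. For $\omega\subseteq\{1,\dots,s\}$, $I_A$ is $T_\omega$-robust if its bouquet ideal is $I_T$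 and $\omega=\{j: B_j\text{ is non-mixed}\}$. Let $S_\omega(T)$ be the set of $u\in \mathrm{Gr}(T)$ such that $D(u)\in S(A)$ for a $T_\omega$-robust ideal $I_A$, and $\Delta_T=\{\omega\subseteq\{1,\dots,s\}: S_\omega(T)=\mathrm{Gr}(T)\}$. Theorem. Let $s\ge 3$ and let $T=(n_1,\dots,n_s)\in\mathbb Z^{1\times s}$ with $\mathrm{Ker}_{\mathbb Z}(T)\cap\mathbb N^s=\{0\}$ (for instance, positive integers $n_j$: a monomial curve). Let $c_j=(c_{j1},\dots,c_{jm_j})\in\mathbb Z^{m_j}$, $m_j\ge1$, $1\le j\le s$, be vectors of full support, each with greatest common divisor of its entries equal to $1$. Suppose that either $\Delta_T=\{\emptyset\}$ and every $c_j$ has positive first entry and at least one negative entry, or $\Delta_T=\{\emptyset,\{i\}\}$ for some $i$ and the same is true of every $c_j$ with $j\ne i$. For every $j$ let $\lambda_{j1},\dots,\lambda_{jm_j}$ be any integers with $\sum_t\lambda_{jt}c_{jt}=1$, and put $$A_j=(\lambda_{j1}n_j,\dots,\lambda_{jm_j}n_j),\qquad C_j=\begin{pmatrix}-c_{j2}&c_{j1}&&\\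 \vdots&&\ddots&\\ -c_{jm_j}&&&c_{j1}\end{pmatrix}\in\mathbb Z^{(m_j-1)\times m_j},$$ $$A=\begin{pmatrix}A_1&A_2&\cdots&A_s\\ C_1&0&\cdots&0\\ 0&C_2&\cdots&0\\ \vdots&\vdots&\ddots&\vdots\\ 0&0&\cdots&C_s\end{pmatrix}\in\mathbb Z^{p\times q},\qquad p=1+\sum_j(m_j-1),\quad q=\sum_j m_j .$$ Then $\mathrm{Ker}_{\mathbb Z}(A)\cap\mathbb N^q=\{0\}$ and the toric ideal $I_A$ is strongly robust. If moreover all first entries $c_{j1}$ are positive (a condition only on $c_i$ in the case $\Delta_T=\{\emptyset,\{i\}\}$), then the bouquets of $A$ are the $s$ blocks of columns, and the bouquet ideal of $I_A$ is $I_T$. -/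

import Mathlib

noncomputable section

namespace BouquetToric

/-! ## Kernels, conformal and semiconformal decompositions -/

section Kernel

variable {ι κ : Type*} [Fintype κ]

/-- The lattice `Ker_ℤ(A)`. -/
def kerZ (A : Matrix ι κ ℤ) : Submodule ℤ (κ → ℤ) :=
  LinearMap.ker A.mulVecLin

/-- The condition `Ker_ℤ(A) ∩ ℕⁿ = {0}`. -/
def IsPointed (A : Matrix ι κ ℤ) : Prop :=
  ∀ u ∈ kerZ A, 0 ≤ u → u = 0

/-- `u = v + w` is a conformal decomposition: `u⁺ = v⁺ + w⁺` and `u⁻ = v⁻ + w⁻`. -/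
def IsConformalSum (u v w : κ → ℤ) : Prop :=
  u = v + w ∧ u⁺ = v⁺ + w⁺ ∧ u⁻ = v⁻ + w⁻

/-- `u = v + w` is a semiconformal decomposition. -/
def IsSemiconformalSum (u v w : κ → ℤ) : Prop :=
  u = v + w ∧ ∀ x, (0 < v x → 0 ≤ w x) ∧ (w x < 0 → v x ≤ 0)

/-- The set `Gr(A)` of primitive vectors: nonzero elements of `Ker_ℤ(A)` that have no proper
conformal decomposition in `Ker_ℤ(A)`. -/
def graver (A : Matrix ι κ ℤ) : Set (κ → ℤ) :=
  {u | u ∈ kerZ A ∧ u ≠ 0 ∧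
    ¬ ∃ v ∈ kerZ A, ∃ w ∈ kerZ A, v ≠ 0 ∧ w ≠ 0 ∧ IsConformalSum u v w}

/-- The set `S(A)` of indispensable vectors: nonzero elements of `Ker_ℤ(A)` that have no proper
semiconformal decomposition in `Ker_ℤ(A)`. -/
def indispensable (A : Matrix ι κ ℤ) : Set (κ → ℤ) :=
  {u | u ∈ kerZ A ∧ u ≠ 0 ∧
    ¬ ∃ v ∈ kerZ A, ∃ w ∈ kerZ A, v ≠ 0 ∧ w ≠ 0 ∧ IsSemiconformalSum u v w}

end Kernel

/-! ## Toric ideals -/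

section Toric

variable {ι κ : Type*} [Fintype κ] (K : Type*) [Field K]

/-- The binomial `x^{u⁺} - x^{u⁻}`. -/
def binomial (u : κ → ℤ) : MvPolynomial κ K :=
  MvPolynomial.monomial (Finsupp.equivFunOnFinite.symm fun x => (u x).toNat) 1 -
    MvPolynomial.monomial (Finsupp.equivFunOnFinite.symm fun x => (-u x).toNat) 1

/-- The toric ideal `I_A`. -/
def toricIdeal (A : Matrix ι κ ℤ) : Ideal (MvPolynomial κ K) :=
  Ideal.span (binomial K '' (kerZ A : Set (κ → ℤ)))

/-- `I_A` is strongly robust: its Graver basis is a minimal system of generators. As usual a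
binomial and its opposite count as one element of the Graver basis, so minimality says that no
pair `± (x^{u⁺} - x^{u⁻})` can be left out. -/
def IsStronglyRobust (A : Matrix ι κ ℤ) : Prop :=
  Ideal.span (binomial K '' graver A) = toricIdeal K A ∧
    ∀ u ∈ graver A, Ideal.span (binomial K '' (graver A \ {u, -u})) ≠ toricIdeal K A

end Toric

/-! ## Gale transforms and the bouquet graph -/

section Gale

variable {ι κ : Type*} [Fintype κ]

/-- A Gale transform of `A`: its columns form a lattice basis of `Ker_ℤ(A)`. (Everything below
is independent of the choice of this basis.) -/
def gale (A : Matrix ι κ ℤ) : Matrix κ (Fin (Module.finrank ℤ (kerZ A))) ℤ :=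
  Matrix.of fun x l => (Module.finBasis ℤ (kerZ A) l : κ → ℤ) x

/-- The row `G(a_x)` of the Gale transform, as a rational vector. -/
def galeRow (A : Matrix ι κ ℤ) (x : κ) : Fin (Module.finrank ℤ (kerZ A)) → ℚ :=
  fun l => (gale A x l : ℚ)

/-- The bouquet graph: two columns are joined when their Gale transforms are rational multiples
of each other. The bouquets are its connected components. -/
def bouquetGraph (A : Matrix ι κ ℤ) : SimpleGraph κ where
  Adj x y := x ≠ y ∧ (∃ q : ℚ, galeRow A x = q • galeRow A y) ∧
    (∃ q : ℚ, galeRow A y = q • galeRow A x)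
  symm := ⟨fun _ _ h => ⟨h.1.symm, h.2.2, h.2.1⟩⟩
  loopless := ⟨fun _ h => h.1 rfl⟩

end Gale

/-! ## Matrices whose columns are listed bouquet by bouquet

The columns are indexed by pairs `(j, t)`: the column `a_{jt}` is the `t`-th vector of the
`j`-th bouquet, which has `k j + 1` elements. -/

section Bouquets

variable {ι : Type*} {s : ℕ} {k : Fin s → ℕ}

/-- The `j`-th block consists of free vectors. -/
def IsFreeBlock (A : Matrix ι (Σ j : Fin s, Fin (k j + 1)) ℤ) (j : Fin s) : Prop :=
  ∀ t, galeRow A ⟨j, t⟩ = 0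

/-- The `j`-th bouquet is non-mixed: its vectors are not free, and along each of its edges the
Gale transforms are positive multiples of each other (it may be an isolated vertex). -/
def IsNonMixedBlock (A : Matrix ι (Σ j : Fin s, Fin (k j + 1)) ℤ) (j : Fin s) : Prop :=
  ¬ IsFreeBlock A j ∧
    ∀ t t', (bouquetGraph A).Adj ⟨j, t⟩ ⟨j, t'⟩ →
      ∃ q : ℚ, 0 < q ∧ galeRow A ⟨j, t⟩ = q • galeRow A ⟨j, t'⟩

/-- `c` lists the entries of the vector `c_{B_j}` on the `j`-th bouquet. For a free bouquet this
is any vector of full support with positive first entry; otherwise it is obtained from a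
coordinate `l` in which all Gale transforms of the bouquet are nonzero, by dividing by the
greatest common divisor and normalizing the sign so that the first entry is positive. -/
def IsBouquetVector (A : Matrix ι (Σ j : Fin s, Fin (k j + 1)) ℤ) (j : Fin s)
    (c : Fin (k j + 1) → ℤ) : Prop :=
  (IsFreeBlock A j ∧ (∀ t, c t ≠ 0) ∧ 0 < c 0) ∨
  (¬ IsFreeBlock A j ∧ ∃ l, (∀ t, gale A ⟨j, t⟩ l ≠ 0) ∧
    ∀ t, c t = (gale A ⟨j, 0⟩ l).sign *
      (gale A ⟨j, t⟩ l / Finset.univ.gcd fun t' => gale A ⟨j, t'⟩ l))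

/-- The bouquets of `A` are exactly the `s` blocks of columns, and `c j` is the vector of the
`j`-th bouquet. -/
def HasBouquets (A : Matrix ι (Σ j : Fin s, Fin (k j + 1)) ℤ)
    (c : ∀ j, Fin (k j + 1) → ℤ) : Prop :=
  (∀ x y, (bouquetGraph A).Reachable x y ↔ x.1 = y.1) ∧ ∀ j, IsBouquetVector A j (c j)

/-- The matrix `A_B` with columns `a_{B_j} = ∑ₜ c_{jt} a_{jt}`. -/
def bouquetMatrix (A : Matrix ι (Σ j : Fin s, Fin (k j + 1)) ℤ)
    (c : ∀ j, Fin (k j + 1) → ℤ) : Matrix ι (Fin s) ℤ :=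
  Matrix.of fun i j => ∑ t, c j t * A i ⟨j, t⟩

/-- `I` is the bouquet ideal of `I_A`, the `j`-th variable corresponding to the `j`-th block. -/
def HasBouquetIdeal (K : Type*) [Field K] (A : Matrix ι (Σ j : Fin s, Fin (k j + 1)) ℤ)
    (I : Ideal (MvPolynomial (Fin s) K)) : Prop :=
  ∃ c, HasBouquets A c ∧ toricIdeal K (bouquetMatrix A c) = I

/-- The map `D(u) = (c_{11} u_1, c_{12} u_1, …, c_{s1} u_s, …)`. -/
def liftD (c : ∀ j, Fin (k j + 1) → ℤ) (u : Fin s → ℤ) : (Σ j : Fin s, Fin (k j + 1)) → ℤ :=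
  fun x => c x.1 x.2 * u x.1

end Bouquets

/-! ## The strongly robust complex -/

section Complex

variable {d s : ℕ} (K : Type*) [Field K]

/-- `I_A` (with bouquet vectors `c`) is a `T_ω`-robust toric ideal: its bouquet ideal is `I_T`
and `ω` is the set of indices of its non-mixed bouquets. -/
def IsOmegaRobust (T : Matrix (Fin d) (Fin s) ℤ) (ω : Set (Fin s)) {p : ℕ} {k : Fin s → ℕ}
    (A : Matrix (Fin p) (Σ j : Fin s, Fin (k j + 1)) ℤ) (c : ∀ j, Fin (k j + 1) → ℤ) : Prop :=
  IsPointed A ∧ HasBouquets A c ∧ toricIdeal K (bouquetMatrix A c) = toricIdeal K T ∧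
    ω = {j | IsNonMixedBlock A j}

/-- The `T_ω`-indispensable set `S_ω(T)`: the `u ∈ Gr(T)` such that `D(u)` is indispensable in a
`T_ω`-robust toric ideal. -/
def omegaIndispensable (T : Matrix (Fin d) (Fin s) ℤ) (ω : Set (Fin s)) : Set (Fin s → ℤ) :=
  {u | u ∈ graver T ∧
    ∃ (p : ℕ) (k : Fin s → ℕ) (A : Matrix (Fin p) (Σ j : Fin s, Fin (k j + 1)) ℤ)
      (c : ∀ j, Fin (k j + 1) → ℤ),
      IsOmegaRobust K T ω A c ∧ liftD c u ∈ indispensable A}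

/-- The strongly robust complex `Δ_T = {ω ⊆ [s] | S_ω(T) = Gr(T)}`. -/
def stronglyRobustComplex (T : Matrix (Fin d) (Fin s) ℤ) : Set (Set (Fin s)) :=
  {ω | omegaIndispensable K T ω = graver T}

end Complex

/-! ## Generalized Lawrence matrices -/

section Lawrence

/-- The matrix `C(c₁, …, c_m)` of size `(m - 1) × m`, with `m = r + 1`: row `a` has `-c_{a+1}`
in the first column, `c₁` in the column `a + 1`, and zeros elsewhere. -/
def blockC {r : ℕ} (c : Fin (r + 1) → ℤ) : Matrix (Fin r) (Fin (r + 1)) ℤ :=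
  Matrix.of fun a b => if b = 0 then -c a.succ else if b = a.succ then c 0 else 0

/-- The matrix `A(n, (c₁, …, c_m)) = (l₁ n, …, l_m n)`, for integers with `∑ lₜ cₜ = 1`. -/
def blockA {r : ℕ} (n : ℤ) (l : Fin (r + 1) → ℤ) : Matrix (Fin 1) (Fin (r + 1)) ℤ :=
  Matrix.of fun _ t => l t * n

/-- The generalized Lawrence matrix: first row `(A_1 | ⋯ | A_s)`, and below it the block
diagonal matrix of `C_1, …, C_s`. -/
def genLawrence {s : ℕ} {r : Fin s → ℕ} (n : Fin s → ℤ) (c l : ∀ j, Fin (r j + 1) → ℤ) :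
    Matrix (Fin 1 ⊕ (Σ j : Fin s, Fin (r j))) (Σ j : Fin s, Fin (r j + 1)) ℤ :=
  Matrix.fromRows (Matrix.of fun i x => blockA (n x.1) (l x.1) i x.2)
    (Matrix.blockDiagonal' fun j => blockC (c j))

/-- The first entry is positive and some entry is negative. -/
def IsMixedVector {r : ℕ} (c : Fin (r + 1) → ℤ) : Prop :=
  0 < c 0 ∧ ∃ t, c t < 0

end Lawrence

end BouquetToric

end

namespace BouquetToric

/-! ## Elementary facts about signs -/

/-! The rows `C_j`, together with `∑ λ_{jt} c_{jt} = 1`, make the kernel of the generalized Lawrence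
matrix exactly `D(Ker T)` (`kerZ_genLawrence`). An indispensable binomial is never generated by
other kernel binomials (`binomial_not_mem_span_of_indispensable`), so strong robustness follows once
every Graver vector is indispensable.

A Graver vector is `D(u)` with `u ∈ Gr(T)`. Take `ω ∈ Δ_T` with at most one element such that `c_j`
has both signs for `j ∉ ω`. If `D(u) = D(v) + D(w)` is semiconformal, the two signs in `c_j` force
`v_j w_j ≥ 0` off `ω`; on the one possible index of `ω`, swapping `v` and `w` gives the required
sign condition. Since `ω ∈ Δ_T`, some `T_ω`-robust matrix `B` lifts `u` to an indispensable vector.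
The bouquet vectors of `B` are positive on `ω`, so `u = v + w` lifts there to a proper semiconformal
decomposition, a contradiction (`graver_subset_indispensable`). -/

lemma isConformalSum_iff {κ : Type*} {u v w : κ → ℤ} :
    IsConformalSum u v w ↔ u = v + w ∧ ∀ x, 0 ≤ v x * w x := by
  have key : ∀ a b : ℤ, ((a + b)⁺ = a⁺ + b⁺ ∧ (a + b)⁻ = a⁻ + b⁻) ↔ 0 ≤ a * b := by
    intro a b
    simp only [posPart_def, negPart_def]
    constructor
    · rintro ⟨h1, h2⟩
      rcases le_total 0 a with ha | ha <;> rcases le_total 0 b with hb | hb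
      · exact mul_nonneg ha hb
      · have : a = 0 ∨ b = 0 := by omega
        rcases this with h | h <;> simp [h]
      · have : a = 0 ∨ b = 0 := by omega
        rcases this with h | h <;> simp [h]
      · exact mul_nonneg_of_nonpos_of_nonpos ha hb
    · intro h
      rcases mul_nonneg_iff.mp h with ⟨ha, hb⟩ | ⟨ha, hb⟩ <;> omega
  constructor
  · rintro ⟨h, h1, h2⟩
    subst h
    exact ⟨rfl, fun x => (key _ _).mp ⟨congrFun h1 x, congrFun h2 x⟩⟩
  · rintro ⟨h, h'⟩
    subst h
    exact ⟨rfl, funext fun x => ((key _ _).mpr (h' x)).1, funext fun x => ((key _ _).mpr (h' x)).2⟩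

/-! ## Toric ideals -/

section Toric

variable {ι κ : Type*} [Fintype κ] (K : Type*) [Field K]

lemma mem_kerZ {A : Matrix ι κ ℤ} {u : κ → ℤ} :
    u ∈ kerZ A ↔ ∀ i, ∑ x, A i x * u x = 0 := by
  simp only [kerZ, LinearMap.mem_ker, Matrix.mulVecLin_apply, funext_iff, Matrix.mulVec,
    dotProduct, Pi.zero_apply]

/-- Sign compatibility makes positive and negative parts additive; the right side then telescopes
through the monomial with exponent `w⁺ + v⁻`. -/
lemma binomial_add {v w : κ → ℤ} (h : ∀ x, 0 ≤ v x * w x) :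
    binomial K (v + w) =
      MvPolynomial.monomial (Finsupp.equivFunOnFinite.symm fun x => (w x).toNat) 1 * binomial K v +
      MvPolynomial.monomial (Finsupp.equivFunOnFinite.symm fun x => (-v x).toNat) 1 *
        binomial K w := by
  have e1 : (Finsupp.equivFunOnFinite.symm fun x => ((v + w) x).toNat : κ →₀ ℕ) =
      (Finsupp.equivFunOnFinite.symm fun x => (w x).toNat) +
        Finsupp.equivFunOnFinite.symm fun x => (v x).toNat := by
    ext x
    rcases mul_nonneg_iff.mp (h x) with ⟨ha, hb⟩ | ⟨ha, hb⟩ <;> simp <;> omega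
  have e2 : (Finsupp.equivFunOnFinite.symm fun x => (-(v + w) x).toNat : κ →₀ ℕ) =
      (Finsupp.equivFunOnFinite.symm fun x => (-v x).toNat) +
        Finsupp.equivFunOnFinite.symm fun x => (-w x).toNat := by
    ext x
    rcases mul_nonneg_iff.mp (h x) with ⟨ha, hb⟩ | ⟨ha, hb⟩ <;> simp <;> omega
  unfold binomial
  rw [e1, e2, mul_sub, mul_sub, MvPolynomial.monomial_mul, MvPolynomial.monomial_mul,
    MvPolynomial.monomial_mul, MvPolynomial.monomial_mul, one_mul,
    add_comm (Finsupp.equivFunOnFinite.symm fun x => (w x).toNat)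
      (Finsupp.equivFunOnFinite.symm fun x => (-v x).toNat)]
  ring

/-- The Graver basis generates the toric ideal. -/
lemma span_graver (A : Matrix ι κ ℤ) :
    Ideal.span (binomial K '' graver A) = toricIdeal K A := by
  apply le_antisymm
  · exact Ideal.span_mono (Set.image_mono fun u hu => hu.1)
  · rw [toricIdeal, Ideal.span_le]
    rintro _ ⟨u, hu, rfl⟩
    -- The 1-norm is additive on conformal sums, so both summands are strictly smaller.
    induction hN : ∑ x, (u x).natAbs using Nat.strong_induction_on generalizing u with
    | _ N ih =>
      by_cases h0 : u = 0
      · subst h0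
        simp [binomial]
      by_cases hg : u ∈ graver A
      · exact Ideal.subset_span ⟨u, hg, rfl⟩
      have hex : ∃ v ∈ kerZ A, ∃ w ∈ kerZ A, v ≠ 0 ∧ w ≠ 0 ∧ IsConformalSum u v w := by
        by_contra h
        exact hg ⟨hu, h0, h⟩
      obtain ⟨v, hv, w, hw, hv0, hw0, hvw⟩ := hex
      rw [isConformalSum_iff] at hvw
      obtain ⟨rfl, hs⟩ := hvw
      have hsum : ∑ x, ((v + w) x).natAbs = ∑ x, (v x).natAbs + ∑ x, (w x).natAbs := by
        rw [← Finset.sum_add_distrib]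
        refine Finset.sum_congr rfl fun x _ => ?_
        simp only [Pi.add_apply]
        rcases mul_nonneg_iff.mp (hs x) with ⟨ha, hb⟩ | ⟨ha, hb⟩ <;> omega
      have hpos : ∀ z : κ → ℤ, z ≠ 0 → 0 < ∑ x, (z x).natAbs := by
        intro z hz
        obtain ⟨x, hx⟩ := Function.ne_iff.mp hz
        exact Finset.sum_pos' (fun _ _ => Nat.zero_le _)
          ⟨x, Finset.mem_univ _, Int.natAbs_pos.mpr hx⟩
      have := hpos v hv0
      have := hpos w hw0
      rw [binomial_add K hs]
      exact add_mem (Ideal.mul_mem_left _ _ (ih _ (by omega) _ hv rfl))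
        (Ideal.mul_mem_left _ _ (ih _ (by omega) _ hw rfl))

/-- The monomials of an element of a binomial ideal are divisible by monomials of generators. -/
lemma exists_le_of_mem_span_binomial {X : Set (κ → ℤ)} {p : MvPolynomial κ K}
    (hp : p ∈ Ideal.span (binomial K '' X)) {m : κ →₀ ℕ} (hm : m ∈ p.support) :
    ∃ v, (v ∈ X ∨ -v ∈ X) ∧ ∀ x, (v x).toNat ≤ m x := by
  set Y : Set (κ →₀ ℕ) := (fun v : κ → ℤ => Finsupp.equivFunOnFinite.symm fun x => (v x).toNat) ''
    {v | v ∈ X ∨ -v ∈ X} with hY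
  have hle : Ideal.span (binomial K '' X) ≤
      Ideal.span ((fun s => MvPolynomial.monomial s (1 : K)) '' Y) := by
    rw [Ideal.span_le]
    rintro _ ⟨v, hv, rfl⟩
    refine sub_mem (Ideal.subset_span ⟨_, ⟨v, Or.inl hv, rfl⟩, rfl⟩)
      (Ideal.subset_span ⟨_, ⟨-v, Or.inr (by simpa using hv), rfl⟩, rfl⟩)
  obtain ⟨_, ⟨v, hv, rfl⟩, hvm⟩ := MvPolynomial.mem_ideal_span_monomial_image.mp (hle hp) m hm
  exact ⟨v, hv, fun x => by simpa using hvm x⟩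

/-- An indispensable binomial cannot be left out of a binomial generating set. -/
lemma binomial_not_mem_span_of_indispensable {A : Matrix ι κ ℤ} {u : κ → ℤ}
    (hu : u ∈ indispensable A) {X : Set (κ → ℤ)} (hX : X ⊆ kerZ A) (hX0 : 0 ∉ X) :
    binomial K u ∉ Ideal.span (binomial K '' (X \ {u, -u})) := by
  classical
  intro hmem
  obtain ⟨hk, h0, hn⟩ := hu
  have hm : (Finsupp.equivFunOnFinite.symm fun x => (u x).toNat : κ →₀ ℕ) ∈
      (binomial K u).support := by
    have hne : (Finsupp.equivFunOnFinite.symm fun x => (-u x).toNat : κ →₀ ℕ) ≠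
        Finsupp.equivFunOnFinite.symm fun x => (u x).toNat := by
      intro h
      apply h0
      funext x
      have := DFunLike.congr_fun h x
      simp at this
      simp only [Pi.zero_apply]
      omega
    rw [MvPolynomial.mem_support_iff, binomial, MvPolynomial.coeff_sub,
      MvPolynomial.coeff_monomial, MvPolynomial.coeff_monomial, if_pos rfl, if_neg hne]
    simp
  obtain ⟨v, hv, hle⟩ := exists_le_of_mem_span_binomial K hmem hm
  have hle' : ∀ x, (v x).toNat ≤ (u x).toNat := fun x => by simpa using hle x
  have hvk : v ∈ kerZ A := by
    rcases hv with h | h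
    · exact hX h.1
    · simpa using neg_mem (hX h.1)
  have hv0 : v ≠ 0 := by
    rintro rfl
    rcases hv with h | h
    · exact hX0 h.1
    · exact hX0 (by simpa using h.1)
  have hvu : v ≠ u := by
    rintro rfl
    rcases hv with h | h <;> exact h.2 (by simp)
  -- Divisibility gives `v⁺ ≤ u⁺`, which is exactly semiconformality of `u = v + (u - v)`.
  refine hn ⟨v, hvk, u - v, sub_mem hk hvk, hv0, sub_ne_zero.mpr hvu.symm, by simp, fun x => ?_⟩
  have := hle' x
  simp only [Pi.sub_apply]
  constructor <;> intro <;> omega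

/-- If all primitive vectors are indispensable, the toric ideal is strongly robust. -/
lemma isStronglyRobust_of_graver_subset {A : Matrix ι κ ℤ} (h : graver A ⊆ indispensable A) :
    IsStronglyRobust K A := by
  refine ⟨span_graver K A, fun u hu heq => ?_⟩
  refine binomial_not_mem_span_of_indispensable K (h hu) (X := graver A) (fun v hv => hv.1)
    (fun h => h.2.1 rfl) ?_
  rw [heq]
  exact Ideal.subset_span ⟨u, hu.1, rfl⟩

lemma toricIdeal_congr {ι' : Type*} {A : Matrix ι κ ℤ} {B : Matrix ι' κ ℤ}
    (h : kerZ A = kerZ B) : toricIdeal K A = toricIdeal K B := by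
  rw [toricIdeal, toricIdeal, h]

/-- The monomial map `x_j ↦ t^{a_j}` to the group algebra. -/
noncomputable def toricMap (A : Matrix ι κ ℤ) : MvPolynomial κ K →ₐ[K] AddMonoidAlgebra K (ι → ℤ) :=
  MvPolynomial.aeval fun x => AddMonoidAlgebra.single (fun i => A i x) 1

lemma toricMap_monomial (A : Matrix ι κ ℤ) (m : κ → ℕ) :
    toricMap K A (MvPolynomial.monomial (Finsupp.equivFunOnFinite.symm m) 1) =
      AddMonoidAlgebra.single (fun i => ∑ x, A i x * (m x : ℤ)) 1 := by
  have hprod : ∀ (S : Finset κ) (f : κ → ι → ℤ),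
      ∏ x ∈ S, (AddMonoidAlgebra.single (f x) 1 : AddMonoidAlgebra K (ι → ℤ)) =
        AddMonoidAlgebra.single (∑ x ∈ S, f x) 1 := by
    classical
    intro S f
    induction S using Finset.induction_on with
    | empty => simp [AddMonoidAlgebra.one_def]
    | insert a S ha ih =>
      rw [Finset.prod_insert ha, Finset.sum_insert ha, ih, AddMonoidAlgebra.single_mul_single,
        one_mul]
  rw [toricMap, MvPolynomial.aeval_monomial, map_one, one_mul,
    Finsupp.prod_fintype _ _ (fun i => pow_zero _)]
  simp only [AddMonoidAlgebra.single_pow, one_pow]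
  rw [hprod]
  congr 1
  funext i
  rw [Finset.sum_apply]
  refine Finset.sum_congr rfl fun x _ => ?_
  simp [mul_comm]

/-- The two monomials map to group elements with exponents `A u⁺` and `A u⁻`, and distinct group
elements have distinct images in the group algebra. -/
lemma toricMap_binomial_eq_zero_iff (A : Matrix ι κ ℤ) (u : κ → ℤ) :
    toricMap K A (binomial K u) = 0 ↔ u ∈ kerZ A := by
  rw [binomial, map_sub, toricMap_monomial, toricMap_monomial, sub_eq_zero, mem_kerZ]
  have e : ∀ i, ∑ x, A i x * u x =
      ∑ x, A i x * ((u x).toNat : ℤ) - ∑ x, A i x * ((-u x).toNat : ℤ) := by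
    intro i
    rw [← Finset.sum_sub_distrib]
    refine Finset.sum_congr rfl fun x _ => ?_
    rw [← mul_sub]
    congr 1
    omega
  simp only [e, sub_eq_zero]
  constructor
  · intro h
    have := (AddMonoidAlgebra.single_left_injective (one_ne_zero : (1 : K) ≠ 0)) h
    exact fun i => congrFun this i
  · intro h
    congr 1
    exact funext h

lemma binomial_mem_toricIdeal_iff {A : Matrix ι κ ℤ} {u : κ → ℤ} :
    binomial K u ∈ toricIdeal K A ↔ u ∈ kerZ A := by
  refine ⟨fun h => ?_, fun h => Ideal.subset_span ⟨u, h, rfl⟩⟩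
  have hle : toricIdeal K A ≤ RingHom.ker (toricMap K A) := by
    rw [toricIdeal, Ideal.span_le]
    rintro _ ⟨v, hv, rfl⟩
    exact (toricMap_binomial_eq_zero_iff K A v).mpr hv
  exact (toricMap_binomial_eq_zero_iff K A u).mp (hle h)

/-- A toric ideal determines the lattice. -/
lemma kerZ_eq_of_toricIdeal_eq {ι' : Type*} {A : Matrix ι κ ℤ} {B : Matrix ι' κ ℤ}
    (h : toricIdeal K A = toricIdeal K B) : kerZ A = kerZ B := by
  ext u
  rw [← binomial_mem_toricIdeal_iff K, h, binomial_mem_toricIdeal_iff]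

end Toric

/-! ## Bouquets -/

section Bouquets

variable {ι : Type*} {s : ℕ} {k : Fin s → ℕ}

lemma liftD_add (c : ∀ j, Fin (k j + 1) → ℤ) (v w : Fin s → ℤ) :
    liftD c (v + w) = liftD c v + liftD c w := by
  funext x
  simp [liftD, mul_add]

lemma liftD_eq_zero_iff {c : ∀ j, Fin (k j + 1) → ℤ} (hc : ∀ j, c j 0 ≠ 0) {u : Fin s → ℤ} :
    liftD c u = 0 ↔ u = 0 := by
  constructor
  · intro h
    funext j
    have := congrFun h ⟨j, 0⟩
    simpa [liftD, hc j] using this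
  · rintro rfl
    funext x
    simp [liftD]

lemma liftD_injective {c : ∀ j, Fin (k j + 1) → ℤ} (hc : ∀ j, c j 0 ≠ 0) :
    Function.Injective (liftD c) := by
  intro u v h
  funext j
  have := congrFun h ⟨j, 0⟩
  simpa [liftD, hc j] using this

lemma liftD_mem_kerZ_iff {A : Matrix ι (Σ j : Fin s, Fin (k j + 1)) ℤ}
    {c : ∀ j, Fin (k j + 1) → ℤ} {u : Fin s → ℤ} :
    liftD c u ∈ kerZ A ↔ u ∈ kerZ (bouquetMatrix A c) := by
  rw [mem_kerZ, mem_kerZ]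
  refine forall_congr' fun i => ?_
  rw [Fintype.sum_sigma]
  simp only [bouquetMatrix, Matrix.of_apply, Finset.sum_mul, liftD]
  simp only [mul_left_comm, mul_comm, mul_assoc]

/-- Mutual proportionality is transitive, so it passes from edges to whole components. -/
lemma exists_smul_of_reachable {κ : Type*} [Fintype κ] {A : Matrix ι κ ℤ} {x y : κ}
    (h : (bouquetGraph A).Reachable x y) :
    (∃ q : ℚ, galeRow A x = q • galeRow A y) ∧ (∃ q : ℚ, galeRow A y = q • galeRow A x) := by
  obtain ⟨p⟩ := h
  induction p with
  | nil => exact ⟨⟨1, (one_smul _ _).symm⟩, ⟨1, (one_smul _ _).symm⟩⟩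
  | cons hadj _ ih =>
    obtain ⟨_, ⟨q, hq⟩, ⟨q', hq'⟩⟩ := hadj
    obtain ⟨⟨a, ha⟩, ⟨b, hb⟩⟩ := ih
    exact ⟨⟨q * a, by rw [hq, ha, smul_smul]⟩, ⟨b * q', by rw [hb, hq', smul_smul]⟩⟩

lemma IsBouquetVector.first_pos {A : Matrix ι (Σ j : Fin s, Fin (k j + 1)) ℤ} {j : Fin s}
    {c : Fin (k j + 1) → ℤ} (h : IsBouquetVector A j c) : 0 < c 0 := by
  rcases h with h | ⟨_, l, hl, hc⟩
  · exact h.2.2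
  · rw [hc 0]
    obtain ⟨e, he⟩ := Finset.gcd_dvd (f := fun t' => gale A ⟨j, t'⟩ l)
      (Finset.mem_univ (0 : Fin (k j + 1)))
    have h0 := hl 0
    set g := Finset.univ.gcd fun t' => gale A ⟨j, t'⟩ l with hg
    have hg0 : 0 ≤ g := by
      rw [hg, ← Finset.normalize_gcd, ← Int.abs_eq_normalize]
      positivity
    have hgne : g ≠ 0 := by
      rintro h
      rw [h, zero_mul] at he
      exact h0 he
    have hgp : 0 < g := lt_of_le_of_ne hg0 hgne.symm
    rw [he, Int.mul_ediv_cancel_left _ hgne, Int.sign_mul, Int.sign_eq_one_of_pos hgp, one_mul,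
      Int.sign_mul_self_eq_abs]
    refine abs_pos.mpr ?_
    rintro rfl
    exact h0 (by simpa using he)

/-- On a non-mixed bouquet all entries of the bouquet vector are positive. -/
lemma HasBouquets.pos_of_isNonMixedBlock {A : Matrix ι (Σ j : Fin s, Fin (k j + 1)) ℤ}
    {c : ∀ j, Fin (k j + 1) → ℤ} (h : HasBouquets A c) {j : Fin s} (hj : IsNonMixedBlock A j)
    (t : Fin (k j + 1)) : 0 < c j t := by
  rcases h.2 j with hf | ⟨_, l, hl, hc⟩
  · exact absurd hf.1 hj.1
  have h0 := (h.2 j).first_pos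
  by_cases ht : t = 0
  · rwa [ht]
  obtain ⟨h1, h2⟩ := exists_smul_of_reachable ((h.1 ⟨j, t⟩ ⟨j, 0⟩).mpr rfl)
  have hadj : (bouquetGraph A).Adj ⟨j, t⟩ ⟨j, 0⟩ := ⟨by simpa using ht, h1, h2⟩
  obtain ⟨q, hq, hrow⟩ := hj.2 t 0 hadj
  have hql : (gale A ⟨j, t⟩ l : ℚ) = q * (gale A ⟨j, 0⟩ l : ℚ) := congrFun hrow l
  obtain ⟨e, he⟩ := Finset.gcd_dvd (f := fun t' => gale A ⟨j, t'⟩ l)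
    (Finset.mem_univ (0 : Fin (k j + 1)))
  obtain ⟨e', he'⟩ := Finset.gcd_dvd (f := fun t' => gale A ⟨j, t'⟩ l) (Finset.mem_univ t)
  have hc0 := hc 0
  have hct := hc t
  have hl0 := hl 0
  set g := Finset.univ.gcd fun t' => gale A ⟨j, t'⟩ l
  have hgne : g ≠ 0 := by
    rintro h
    rw [h, zero_mul] at he
    exact hl0 he
  have hgq : (g : ℚ) ≠ 0 := by exact_mod_cast hgne
  rw [he, he'] at hql
  push_cast at hql
  have hee : (e' : ℚ) = q * e := by
    apply mul_left_cancel₀ hgq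
    linarith
  rw [show gale A ⟨j, t⟩ l / g = e' by rw [he', Int.mul_ediv_cancel_left _ hgne]] at hct
  rw [show gale A ⟨j, 0⟩ l / g = e by
    conv_lhs => rw [he]
    rw [Int.mul_ediv_cancel_left _ hgne]] at hc0
  rw [hc0] at h0
  have : (0 : ℚ) < (c j t : ℚ) := by
    rw [hct]
    push_cast
    rw [hee, mul_left_comm]
    exact mul_pos hq (by exact_mod_cast h0)
  exact_mod_cast this

/-- Linear relations between two rows of a Gale transform hold on the whole kernel. -/
lemma relation_of_gale {κ : Type*} [Fintype κ] {A : Matrix ι κ ℤ} {x y : κ} {a b : ℤ}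
    (h : ∀ l, a * gale A x l = b * gale A y l) {u : κ → ℤ} (hu : u ∈ kerZ A) :
    a * u x = b * u y := by
  -- Both sides are linear functionals on the kernel, and the columns of the Gale transform form a
  -- basis of it.
  have hf : (a • (LinearMap.proj x : (κ → ℤ) →ₗ[ℤ] ℤ)) ∘ₗ (kerZ A).subtype =
      (b • (LinearMap.proj y : (κ → ℤ) →ₗ[ℤ] ℤ)) ∘ₗ (kerZ A).subtype := by
    refine (Module.finBasis ℤ (kerZ A)).ext fun l => ?_
    simpa [gale] using h l
  simpa using LinearMap.congr_fun hf ⟨u, hu⟩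

end Bouquets

/-! ## Transfer of indispensability -/

section Transfer

variable {d s : ℕ} (K : Type*) [Field K]

/-- If `ω` has at most one element, lies in the strongly robust complex of `T` and all blocks
outside `ω` are mixed, then a matrix with kernel `D(Ker T)` has only indispensable primitive
vectors. -/
lemma graver_subset_indispensable {ι : Type*} {T : Matrix (Fin d) (Fin s) ℤ} {ω : Set (Fin s)}
    (hω : ω.Subsingleton) (hΔ : ω ∈ stronglyRobustComplex K T) {r : Fin s → ℕ}
    {A : Matrix ι (Σ j : Fin s, Fin (r j + 1)) ℤ} {c : ∀ j, Fin (r j + 1) → ℤ}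
    (hc0 : ∀ j, c j 0 ≠ 0) (hmix : ∀ j ∉ ω, IsMixedVector (c j))
    (hker : ∀ x, x ∈ kerZ A ↔ ∃ u ∈ kerZ T, x = liftD c u) :
    graver A ⊆ indispensable A := by
  rintro x ⟨hx, hx0, hxn⟩
  obtain ⟨u, hu, rfl⟩ := (hker x).mp hx
  have hug : u ∈ graver T := by
    refine ⟨hu, fun h => hx0 ((liftD_eq_zero_iff hc0).mpr h), ?_⟩
    rintro ⟨v, hv, w, hw, hv0, hw0, hvw⟩
    rw [isConformalSum_iff] at hvw
    refine hxn ⟨liftD c v, (hker _).mpr ⟨v, hv, rfl⟩, liftD c w, (hker _).mpr ⟨w, hw, rfl⟩,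
      (liftD_eq_zero_iff hc0).not.mpr hv0, (liftD_eq_zero_iff hc0).not.mpr hw0,
      isConformalSum_iff.mpr ⟨by rw [hvw.1, liftD_add], fun x => ?_⟩⟩
    have : liftD c v x * liftD c w x = (c x.1 x.2) ^ 2 * (v x.1 * w x.1) := by
      simp only [liftD]
      ring
    rw [this]
    exact mul_nonneg (sq_nonneg _) (hvw.2 _)
  refine ⟨hx, hx0, ?_⟩
  rintro ⟨v', hv', w', hw', hv0', hw0', hsum, hsemi⟩
  obtain ⟨v, hv, rfl⟩ := (hker v').mp hv'
  obtain ⟨w, hw, rfl⟩ := (hker w').mp hw'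
  have hv0 := (liftD_eq_zero_iff hc0).not.mp hv0'
  have hw0 := (liftD_eq_zero_iff hc0).not.mp hw0'
  have huvw : u = v + w := liftD_injective hc0 (by rw [hsum, liftD_add])
  have hconf : ∀ j ∉ ω, 0 ≤ v j * w j := by
    intro j hj
    obtain ⟨hpos, t, ht⟩ := hmix j hj
    have h1 := hsemi ⟨j, 0⟩
    have h2 := hsemi ⟨j, t⟩
    simp only [liftD] at h1 h2
    -- The entry of `c j` with the same sign as `v j` makes `D(v)` positive there, so `D(w)` is
    -- nonnegative there.
    rcases lt_trichotomy (v j) 0 with hneg | h0 | hp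
    · have := h2.1 (mul_pos_of_neg_of_neg ht hneg)
      exact mul_nonneg_of_nonpos_of_nonpos hneg.le (by nlinarith)
    · simp [h0]
    · have := h1.1 (mul_pos hpos hp)
      exact mul_nonneg hp.le (by nlinarith)
  -- it is enough to decompose `u` with the right sign condition on `ω`
  have main : ∀ v ∈ kerZ T, ∀ w ∈ kerZ T, v ≠ 0 → w ≠ 0 → u = v + w →
      (∀ j ∉ ω, 0 ≤ v j * w j) → (∀ j ∈ ω, 0 < v j → 0 ≤ w j) → False := by
    intro v hv w hw hv0 hw0 huvw hconf hsign
    have hu' : u ∈ omegaIndispensable K T ω := by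
      rw [show omegaIndispensable K T ω = graver T from hΔ]
      exact hug
    obtain ⟨_, p, k, B, b, ⟨_, hB, hideal, homega⟩, hind⟩ := hu'
    -- Equal toric ideals give equal lattices, so `v` and `w` also lift into the kernel of `B`.
    have hkerB := kerZ_eq_of_toricIdeal_eq K hideal
    have hb0 : ∀ j, b j 0 ≠ 0 := fun j => (hB.2 j).first_pos.ne'
    refine hind.2.2 ⟨liftD b v, liftD_mem_kerZ_iff.mpr (hkerB ▸ hv), liftD b w,
      liftD_mem_kerZ_iff.mpr (hkerB ▸ hw), (liftD_eq_zero_iff hb0).not.mpr hv0,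
      (liftD_eq_zero_iff hb0).not.mpr hw0, by rw [huvw, liftD_add], fun x => ?_⟩
    have key : ¬ (0 < liftD b v x ∧ liftD b w x < 0) := by
      rintro ⟨h1, h2⟩
      have hlt : liftD b v x * liftD b w x < 0 := mul_neg_of_pos_of_neg h1 h2
      by_cases hj : x.1 ∈ ω
      · have hbp : 0 < b x.1 x.2 := hB.pos_of_isNonMixedBlock (by rw [homega] at hj; exact hj) _
        simp only [liftD] at h1 h2
        have := hsign x.1 hj (pos_of_mul_pos_right h1 hbp.le)
        have := mul_nonneg hbp.le this
        omega
      · have : liftD b v x * liftD b w x = (b x.1 x.2) ^ 2 * (v x.1 * w x.1) := by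
          simp only [liftD]
          ring
        rw [this] at hlt
        exact absurd hlt (not_lt.mpr (mul_nonneg (sq_nonneg _) (hconf _ hj)))
    constructor <;> intro <;> by_contra <;> exact key (by omega)
  by_cases hall : ∀ j ∈ ω, 0 < v j → 0 ≤ w j
  · exact main v hv w hw hv0 hw0 huvw hconf hall
  -- Failure means `v i > 0 > w i`. After the swap the condition at `i` is vacuous, and `ω` has no
  -- other index.
  · push Not at hall
    obtain ⟨i, hi, hvi, hwi⟩ := hall
    refine main w hw v hv hw0 hv0 (by rw [huvw, add_comm])
      (fun j hj => by rw [mul_comm]; exact hconf j hj) fun j hj hwj => ?_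
    rw [hω hj hi] at hwj
    omega

end Transfer

/-! ## Generalized Lawrence matrices -/

section Lawrence

variable {s : ℕ} {r : Fin s → ℕ}

lemma mem_kerZ_genLawrence_iff {n : Fin s → ℤ} {c l : ∀ j, Fin (r j + 1) → ℤ}
    {u : (Σ j : Fin s, Fin (r j + 1)) → ℤ} :
    u ∈ kerZ (genLawrence n c l) ↔
      (∑ j, n j * ∑ t, l j t * u ⟨j, t⟩ = 0) ∧
        ∀ j (a : Fin (r j)), c j 0 * u ⟨j, a.succ⟩ = c j a.succ * u ⟨j, 0⟩ := by
  rw [mem_kerZ]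
  simp only [Sum.forall, Sigma.forall]
  refine and_congr ?_ ?_
  · simp only [genLawrence, Matrix.fromRows_apply_inl, Matrix.of_apply, blockA, Unique.forall_iff,
      Fintype.sum_sigma, Finset.mul_sum]
    simp only [mul_left_comm, mul_assoc]
  · refine forall_congr' fun j => forall_congr' fun a => ?_
    simp only [genLawrence, Matrix.fromRows_apply_inr, Fintype.sum_sigma]
    rw [Finset.sum_eq_single j]
    · rw [Fin.sum_univ_succ, Finset.sum_eq_single a]
      · simp [Matrix.blockDiagonal'_apply_eq, blockC]
        constructor <;> intro h <;> linarith
      · intro b _ hb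
        simp [Matrix.blockDiagonal'_apply_eq, blockC, hb]
      · simp
    · intro j' _ hj'
      refine Finset.sum_eq_zero fun t _ => ?_
      rw [Matrix.blockDiagonal'_apply_ne _ _ _ hj'.symm, zero_mul]
    · simp

/-- The rows of `C_j` make `x` proportional to `c j` on block `j`; the Bézout coefficients `l j`
extract the integral factor `u j`, and the first row then reads `T u = 0`. -/
lemma kerZ_genLawrence {T : Matrix (Fin 1) (Fin s) ℤ} {c l : ∀ j, Fin (r j + 1) → ℤ}
    (hc0 : ∀ j, c j 0 ≠ 0) (hl : ∀ j, ∑ t, l j t * c j t = 1)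
    (x : (Σ j : Fin s, Fin (r j + 1)) → ℤ) :
    x ∈ kerZ (genLawrence (T 0) c l) ↔ ∃ u ∈ kerZ T, x = liftD c u := by
  rw [mem_kerZ_genLawrence_iff]
  constructor
  · rintro ⟨h1, h2⟩
    refine ⟨fun j => ∑ t, l j t * x ⟨j, t⟩, mem_kerZ.mpr fun i => ?_, ?_⟩
    · rw [Subsingleton.elim i 0]
      exact h1
    · have h3 : ∀ j t, c j 0 * x ⟨j, t⟩ = c j t * x ⟨j, 0⟩ := by
        intro j t
        cases t using Fin.cases with
        | zero => rfl
        | succ a => exact h2 j a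
      funext ⟨j, t⟩
      apply mul_left_cancel₀ (hc0 j)
      simp only [liftD]
      calc c j 0 * x ⟨j, t⟩ = (c j t * x ⟨j, 0⟩) * ∑ t', l j t' * c j t' := by
            rw [hl, mul_one, h3]
        _ = ∑ t', c j t * l j t' * (c j t' * x ⟨j, 0⟩) := by
            rw [Finset.mul_sum]
            exact Finset.sum_congr rfl fun t' _ => by ring
        _ = ∑ t', c j t * l j t' * (c j 0 * x ⟨j, t'⟩) := by simp only [h3]
        _ = c j 0 * (c j t * ∑ t', l j t' * x ⟨j, t'⟩) := by
            rw [Finset.mul_sum, Finset.mul_sum]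
            exact Finset.sum_congr rfl fun t' _ => by ring
  · rintro ⟨u, hu, rfl⟩
    constructor
    · have h := mem_kerZ.mp hu 0
      rw [← h]
      refine Finset.sum_congr rfl fun j _ => ?_
      congr 1
      simp only [liftD, ← mul_assoc, ← Finset.sum_mul, hl, one_mul]
    · intro j a
      simp only [liftD]
      ring

/-- All entries of a pointed `1 × s` matrix are nonzero. -/
lemma IsPointed.entry_ne_zero {T : Matrix (Fin 1) (Fin s) ℤ} (hT : IsPointed T) (j : Fin s) :
    T 0 j ≠ 0 := by
  intro h
  have hmem : (Pi.single j 1 : Fin s → ℤ) ∈ kerZ T := by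
    rw [mem_kerZ]
    intro i
    rw [Subsingleton.elim i 0, Finset.sum_eq_single j]
    · simp [h]
    · intro b _ hb
      simp [hb]
    · simp
  have := hT _ hmem (Pi.single_nonneg.mpr zero_le_one)
  simpa using congrFun this j

/-- The kernel of a row contains a vector supported exactly on two given coordinates. -/
lemma exists_mem_kerZ_two {T : Matrix (Fin 1) (Fin s) ℤ} (hT : ∀ j, T 0 j ≠ 0) {i j : Fin s}
    (hij : i ≠ j) : ∃ u ∈ kerZ T, u i ≠ 0 ∧ ∀ k, k ≠ i → k ≠ j → u k = 0 := by
  refine ⟨Pi.single i (T 0 j) - Pi.single j (T 0 i), mem_kerZ.mpr fun a => ?_, ?_, ?_⟩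
  · rw [Subsingleton.elim a 0]
    simp only [Pi.sub_apply, mul_sub, Finset.sum_sub_distrib]
    rw [Finset.sum_eq_single i, Finset.sum_eq_single j]
    · simp [mul_comm]
    all_goals simp +contextual
  · simp [hij, hT j]
  · intro k h1 h2
    simp [h1, h2]

lemma exists_ne_ne (hs : 3 ≤ s) (i j : Fin s) : ∃ k, k ≠ i ∧ k ≠ j := by
  have hcard : ({i, j} : Finset (Fin s)).card < Fintype.card (Fin s) := by
    rw [Fintype.card_fin]
    exact lt_of_le_of_lt Finset.card_le_two (by omega)
  obtain ⟨k, hk⟩ := Finset.exists_mem_notMem_of_card_lt_card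
    (s := {i, j}) (t := Finset.univ) (by simpa using hcard)
  exact ⟨k, by simpa using hk⟩

lemma hasBouquets_of_kerZ {ι : Type*} (hs : 3 ≤ s) {T : Matrix (Fin 1) (Fin s) ℤ}
    (hT : ∀ j, T 0 j ≠ 0) {A : Matrix ι (Σ j : Fin s, Fin (r j + 1)) ℤ}
    {c : ∀ j, Fin (r j + 1) → ℤ} (hfull : ∀ j t, c j t ≠ 0)
    (hprim : ∀ j, Finset.univ.gcd (c j) = 1) (hpos : ∀ j, 0 < c j 0)
    (hker : ∀ x, x ∈ kerZ A ↔ ∃ u ∈ kerZ T, x = liftD c u) :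
    HasBouquets A c := by
  have hg : ∀ l, ∃ u : Fin s → ℤ, ∀ j t, gale A ⟨j, t⟩ l = c j t * u j := by
    intro l
    obtain ⟨u, _, hu⟩ := (hker _).mp (Module.finBasis ℤ (kerZ A) l).2
    exact ⟨u, fun j t => congrFun hu ⟨j, t⟩⟩
  choose g hg using hg
  have hprop : ∀ j t t', ∃ q : ℚ, galeRow A ⟨j, t⟩ = q • galeRow A ⟨j, t'⟩ := by
    intro j t t'
    refine ⟨c j t / c j t', funext fun l => ?_⟩
    have : (c j t' : ℚ) ≠ 0 := by exact_mod_cast hfull j t'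
    simp only [galeRow, hg, Pi.smul_apply, smul_eq_mul]
    push_cast
    field_simp
  constructor
  · rintro ⟨j, t⟩ ⟨j', t'⟩
    constructor
    · intro h
      by_contra hne
      change j ≠ j' at hne
      obtain ⟨⟨q, hq⟩, _⟩ := exists_smul_of_reachable h
      obtain ⟨k, hk, hk'⟩ := exists_ne_ne hs j j'
      -- A third index `k`, available as `s ≥ 3`, gives a kernel vector nonzero at `j` but zero at
      -- `j'`, so the two blocks cannot be proportional.
      obtain ⟨u, hu, hu1, hu2⟩ := exists_mem_kerZ_two hT hk.symm
      have hrel := relation_of_gale (A := A) (x := ⟨j, t⟩) (y := ⟨j', t'⟩) (a := q.den) (b := q.num)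
        (fun l => by
          have h1 : (gale A ⟨j, t⟩ l : ℚ) = q * (gale A ⟨j', t'⟩ l : ℚ) := congrFun hq l
          have h2 : (q.den : ℚ) * (gale A ⟨j, t⟩ l : ℚ) = q.num * (gale A ⟨j', t'⟩ l : ℚ) := by
            rw [h1, ← mul_assoc, Rat.den_mul_eq_num]
          exact_mod_cast h2) ((hker _).mpr ⟨u, hu, rfl⟩)
      simp only [liftD] at hrel
      rw [hu2 j' (Ne.symm hne) hk'.symm, mul_zero, mul_zero] at hrel
      exact mul_ne_zero (by exact_mod_cast q.den_nz) (mul_ne_zero (hfull j t) hu1) hrel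
    · rintro h
      change j = j' at h
      subst h
      by_cases htt : t = t'
      · rw [htt]
      · exact SimpleGraph.Adj.reachable
          ⟨by simpa using htt, hprop j t t', hprop j t' t⟩
  · intro j
    have hex : ∃ l, g l j ≠ 0 := by
      by_contra! hall
      obtain ⟨k, hk, _⟩ := exists_ne_ne hs j j
      obtain ⟨u, hu, hu1, _⟩ := exists_mem_kerZ_two hT hk.symm
      have hrel := relation_of_gale (A := A) (x := ⟨j, 0⟩) (y := ⟨j, 0⟩) (a := 1) (b := 0)
        (fun l => by simp [hg, hall]) ((hker _).mpr ⟨u, hu, rfl⟩)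
      simp only [liftD, one_mul, zero_mul] at hrel
      exact mul_ne_zero (hfull j 0) hu1 hrel
    obtain ⟨l, hl⟩ := hex
    have hne : ∀ t, gale A ⟨j, t⟩ l ≠ 0 := fun t => by
      rw [hg]
      exact mul_ne_zero (hfull j t) hl
    refine Or.inr ⟨fun hfree => hne 0 ?_, l, hne, fun t => ?_⟩
    · have := congrFun (hfree 0) l
      simpa [galeRow] using this
    · simp only [hg]
      -- As `c j` is primitive, the gcd is `|g l j|`; the sign left after division cancels against
      -- the normalizing sign.
      rw [Finset.gcd_mul_right, hprim, one_mul, ← Int.abs_eq_normalize, Int.sign_mul,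
        Int.sign_eq_one_of_pos (hpos j), one_mul]
      rcases lt_or_gt_of_ne hl with h | h
      · rw [Int.sign_eq_neg_one_of_neg h, abs_of_neg h, Int.ediv_neg, Int.mul_ediv_cancel _ hl]
        ring
      · rw [Int.sign_eq_one_of_pos h, abs_of_pos h, Int.mul_ediv_cancel _ hl, one_mul]

/-- Both signs in `c j` force `u j = 0` off `ω`; at most one coordinate remains, and `T u = 0` kills
it because the entries of `T` are nonzero. -/
lemma isPointed_of_kerZ {ι : Type*} {T : Matrix (Fin 1) (Fin s) ℤ}
    (hT : ∀ j, T 0 j ≠ 0) {ω : Set (Fin s)} (hω : ω.Subsingleton)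
    {A : Matrix ι (Σ j : Fin s, Fin (r j + 1)) ℤ} {c : ∀ j, Fin (r j + 1) → ℤ}
    (hmix : ∀ j ∉ ω, IsMixedVector (c j))
    (hker : ∀ x, x ∈ kerZ A ↔ ∃ u ∈ kerZ T, x = liftD c u) : IsPointed A := by
  intro x hx hx0
  obtain ⟨u, hu, rfl⟩ := (hker x).mp hx
  have h1 : ∀ j ∉ ω, u j = 0 := by
    intro j hj
    obtain ⟨hp, t, ht⟩ := hmix j hj
    have h0 : 0 ≤ c j 0 * u j := hx0 ⟨j, 0⟩
    have ht' : 0 ≤ c j t * u j := hx0 ⟨j, t⟩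
    exact le_antisymm (nonpos_of_mul_nonneg_right ht' ht) (nonneg_of_mul_nonneg_right h0 hp)
  have h2 : u = 0 := by
    funext j
    by_cases hj : j ∈ ω
    · have h := mem_kerZ.mp hu 0
      rw [Finset.sum_eq_single j (fun b _ hb => by
        rw [h1 b (fun hb' => hb (hω hb' hj)), mul_zero]) (by simp)] at h
      exact (mul_eq_zero.mp h).resolve_left (hT j)
    · exact h1 j hj
  subst h2
  funext x
  simp [liftD]

end Lawrence

end BouquetToric

theorem mainTheorem6 (K : Type*) [Field K] (s : ℕ) (hs : 3 ≤ s)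
    (T : Matrix (Fin 1) (Fin s) ℤ) (hT : BouquetToric.IsPointed T)
    (r : Fin s → ℕ) (c l : ∀ j : Fin s, Fin (r j + 1) → ℤ)
    (hfull : ∀ j t, c j t ≠ 0)
    (hprim : ∀ j, Finset.univ.gcd (c j) = 1)
    (hl : ∀ j, ∑ t, l j t * c j t = 1)
    (hc : (BouquetToric.stronglyRobustComplex K T = {∅} ∧
            ∀ j, BouquetToric.IsMixedVector (c j)) ∨
          (∃ i, BouquetToric.stronglyRobustComplex K T = {∅, {i}} ∧
            ∀ j, j ≠ i → BouquetToric.IsMixedVector (c j))) :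
    BouquetToric.IsPointed (BouquetToric.genLawrence (T 0) c l) ∧
    BouquetToric.IsStronglyRobust K (BouquetToric.genLawrence (T 0) c l) ∧
    ((∀ j, 0 < c j 0) →
      BouquetToric.HasBouquetIdeal K (BouquetToric.genLawrence (T 0) c l)
        (BouquetToric.toricIdeal K T)) := by
  have hker := BouquetToric.kerZ_genLawrence (T := T) (c := c) (l := l) (fun j => hfull j 0) hl
  have hn := hT.entry_ne_zero
  obtain ⟨ω, hω, hΔ, hmix⟩ : ∃ ω : Set (Fin s), ω.Subsingleton ∧
      ω ∈ BouquetToric.stronglyRobustComplex K T ∧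
      ∀ j ∉ ω, BouquetToric.IsMixedVector (c j) := by
    rcases hc with ⟨h, hm⟩ | ⟨i, h, hm⟩
    · exact ⟨∅, Set.subsingleton_empty, by simp [h], fun j _ => hm j⟩
    · exact ⟨{i}, Set.subsingleton_singleton, by simp [h], fun j hj => hm j (by simpa using hj)⟩
  refine ⟨BouquetToric.isPointed_of_kerZ hn hω hmix hker,
    BouquetToric.isStronglyRobust_of_graver_subset K
      (BouquetToric.graver_subset_indispensable K hω hΔ (fun j => hfull j 0) hmix hker),
    fun hpos => ⟨c, BouquetToric.hasBouquets_of_kerZ hs hn hfull hprim hpos hker,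
      BouquetToric.toricIdeal_congr K ?_⟩⟩
  -- The bouquet matrix has kernel `Ker T`: `D(u)` lies in `D(Ker T)` exactly when `u ∈ Ker T`, as
  -- `D` is injective.
  ext u
  rw [← BouquetToric.liftD_mem_kerZ_iff, hker]
  constructor
  · rintro ⟨v, hv, h⟩
    rwa [BouquetToric.liftD_injective (fun j => hfull j 0) h]
  · exact fun hu => ⟨u, hu, rfl⟩
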